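/- Let $(\Omega,\mathcal F,\mathbb P)$ be a probability space and let $\mathcal G\subseteq\mathcal F$ be a sub-$\sigma$-algebra on which $\mathbb P$ is atomless, i.e. $\{\mathbb P(B): B\in\mathcal G,\ B\subseteq A\}=[0,\mathbb P(A)]$ for every $A\in\mathcal G$. Let $\mathcal X$ be the set of bounded $\mathcal F$-measurable functions $X:\Omega\to\mathbb R$. A capacity is a function $\nu:\mathcal F\to\mathbb R$ with $\nu(\varnothing)=0$, $\nu(\Omega)=1$ and $\nu(A)\le\nu(B)$ whenever $A\subseteq B$; it is continuous if $\nu(A_n)\to\nu(\bigcup_k A_k)$ for increasing and $\nu(A_n)\to\nu(\bigcap_k A_k)$ for decreasing sequences $(A_n)$ in $\mathcal F$; it is risk conforming if $\nu=\mathbb P$ on $\mathcal G$; and it is supermodular if $\nu(A)+\nu(B)\le\nu(A\cup B)+\nu(A\cap B)$ for all $A,B\in\mathcal F$. The Choquet integral of $X\in\mathcal X$ with respect to a capacity $\nu$ is $$\int X\,\mathrm d\nu=\int_0^\infty \nu(X>x)\,\mathrm dx+\int_{-\infty}^0\bigl(\nu(X>x)-1\bigr)\,\mathrm dx,$$ and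 the core $\mathrm{core}(\nu)$ is the set of countably additive probability measures $\mu$ on $(\Omega,\mathcal F)$ with $\mu(A)\ge\nu(A)$ for all $A\in\mathcal F$. Theorem. Let $\succsim$ be a Choquet rank-dependent utility (CRDU) preference relation on $\mathcal X$, that is, a total preorder on $\mathcal X$ for which there are a strictly increasing continuous $u:\mathbb R\to\mathbb R$, a strictly increasing continuous $g:[0,1]\to[0,1]$ with $g(0)=0$ and $g(1)=1$, and a continuous risk-conforming capacity $\nu$ such that $$X\succsim Y\iff\int u(X)\,\mathrm d(g\circ\nu)\ge\int u(Y)\,\mathrm d(g\circ\nu)\qquad\text{for all }X,Y\in\mathcal X,$$ and let $(u,g,\nu)$ be such a representation. Then the robust aggregation property $$X\succsim Y\iff\min_{\mu\in\mathrm{core}(\nu)}\int u(X)\,\mathrm d(g\circ\mu)\ge\min_{\mu\in\mathrm{core}(\nu)}\int u(Y)\,\mathrm d(g\circ\mu)\qquad\text{for all }X,Y\in\mathcal X$$ (which includes the existence of these minima, so in particular $\mathrm{core}(\nu)\ne\varnothing$) holds if and only if $\nu$ is supermodular. -/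

import Mathlib

open MeasureTheory Filter Topology Set

noncomputable section

namespace CRDU

/-- An act on the measurable space `Ω`: a bounded real-valued measurable function. -/
structure Act (Ω : Type*) [MeasurableSpace Ω] where
  toFun : Ω → ℝ
  measurable' : Measurable toFun
  bounded' : ∃ C : ℝ, ∀ ω, |toFun ω| ≤ C

/-- A preference relation: a total preorder on acts; `pref X Y` means that `X` is weakly
preferred to `Y`. -/
structure IsPreferenceRelation {Ω : Type*} [MeasurableSpace Ω]
    (pref : Act Ω → Act Ω → Prop) : Prop where
  total : ∀ X Y, pref X Y ∨ pref Y X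
  trans : ∀ X Y Z, pref X Y → pref Y Z → pref X Z

/-- A capacity on the σ-algebra of `Ω`. Set functions are total functions on `Set Ω`, but only
their values on measurable sets are ever constrained or used. -/
structure IsCapacity {Ω : Type*} [MeasurableSpace Ω] (ν : Set Ω → ℝ) : Prop where
  empty : ν ∅ = 0
  univ : ν Set.univ = 1
  mono : ∀ A B, MeasurableSet A → MeasurableSet B → A ⊆ B → ν A ≤ ν B

/-- A continuous capacity: a capacity continuous along increasing and decreasing sequences of
measurable sets. -/
structure IsContinuousCapacity {Ω : Type*} [MeasurableSpace Ω] (ν : Set Ω → ℝ) : Prop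
    extends IsCapacity ν where
  upward : ∀ A : ℕ → Set Ω, (∀ n, MeasurableSet (A n)) → Monotone A →
    Tendsto (fun n => ν (A n)) atTop (𝓝 (ν (⋃ n, A n)))
  downward : ∀ A : ℕ → Set Ω, (∀ n, MeasurableSet (A n)) → Antitone A →
    Tendsto (fun n => ν (A n)) atTop (𝓝 (ν (⋂ n, A n)))

/-- Supermodularity of a set function on the measurable sets. -/
def IsSupermodular {Ω : Type*} [MeasurableSpace Ω] (ν : Set Ω → ℝ) : Prop :=
  ∀ A B, MeasurableSet A → MeasurableSet B → ν A + ν B ≤ ν (A ∪ B) + ν (A ∩ B)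

/-- The core of `ν`: the (countably additive) probability measures dominating `ν`. -/
def core {Ω : Type*} [MeasurableSpace Ω] (ν : Set Ω → ℝ) : Set (ProbabilityMeasure Ω) :=
  {μ | ∀ A, MeasurableSet A → ν A ≤ (μ : Measure Ω).real A}

/-- The Choquet integral of `f` with respect to `ν`. For a capacity and a bounded measurable `f`,
both integrands are monotone and vanish outside a bounded interval, hence are integrable. -/
def choquet {Ω : Type*} (ν : Set Ω → ℝ) (f : Ω → ℝ) : ℝ :=
  (∫ x in Set.Ioi (0 : ℝ), ν {ω | x < f ω}) + ∫ x in Set.Iic (0 : ℝ), (ν {ω | x < f ω} - 1)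

/-- The probability space `(Ω, 𝒢, P|𝒢)` is atomless: within every `A ∈ 𝒢` the probabilities of
the events of `𝒢` fill the whole interval `[0, P(A)]`. -/
def IsAtomless {Ω : Type*} (𝒢 : MeasurableSpace Ω) [mΩ : MeasurableSpace Ω]
    (P : Measure Ω) : Prop :=
  ∀ A, MeasurableSet[𝒢] A →
    {p : ℝ | ∃ B, MeasurableSet[𝒢] B ∧ B ⊆ A ∧ P.real B = p} = Set.Icc 0 (P.real A)

/-- `ν` is risk conforming: it agrees with the reference probability `P` on `𝒢`. -/
def IsRiskConforming {Ω : Type*} (𝒢 : MeasurableSpace Ω) [mΩ : MeasurableSpace Ω]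
    (P : Measure Ω) (ν : Set Ω → ℝ) : Prop :=
  ∀ A, MeasurableSet[𝒢] A → ν A = P.real A

/-- A strictly increasing continuous distortion function `[0,1] → [0,1]`; the values of `g`
outside `[0,1]` are irrelevant. -/
structure IsStrictContDistortion (g : ℝ → ℝ) : Prop where
  zero : g 0 = 0
  one : g 1 = 1
  strictMonoOn : StrictMonoOn g (Set.Icc 0 1)
  continuousOn : ContinuousOn g (Set.Icc 0 1)

/-- `pref` is a Choquet rank-dependent utility preference relation with representation
`(u, g, ν)`. -/
structure IsCRDU {Ω : Type*} (𝒢 : MeasurableSpace Ω) [mΩ : MeasurableSpace Ω] (P : Measure Ω)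
    (pref : Act Ω → Act Ω → Prop) (u g : ℝ → ℝ) (ν : Set Ω → ℝ) : Prop where
  utility_strictMono : StrictMono u
  utility_continuous : Continuous u
  distortion : IsStrictContDistortion g
  capacity : IsContinuousCapacity ν
  riskConforming : IsRiskConforming 𝒢 P ν
  rep : ∀ X Y : Act Ω, pref X Y ↔
    choquet (fun A => g (ν A)) (fun ω => u (X.toFun ω)) ≥
      choquet (fun A => g (ν A)) (fun ω => u (Y.toFun ω))

/-- Robust aggregation: for every act `X` the minimum over the core of the rank-dependent
utilities of `X` exists, and preferences are given by comparing these minima. -/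
def RobustAggregation {Ω : Type*} [MeasurableSpace Ω]
    (pref : Act Ω → Act Ω → Prop) (u g : ℝ → ℝ) (ν : Set Ω → ℝ) : Prop :=
  ∃ V : Act Ω → ℝ,
    (∀ X : Act Ω, IsLeast
      ((fun μ : ProbabilityMeasure Ω =>
        choquet (fun A => g ((μ : Measure Ω).real A)) (fun ω => u (X.toFun ω))) '' core ν)
      (V X)) ∧
    ∀ X Y : Act Ω, pref X Y ↔ V X ≥ V Y

end CRDU

end

/-! Every `μ ∈ core ν` dominates `ν`, so the functional of `g ∘ ν` bounds that of `g ∘ μ` from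
below; what matters is whether some core measure attains the bound. If `ν` is supermodular, the
upper level sets of `u ∘ X` form a chain, and some `μ` in the core equals `ν` on that chain: a
maximal supermodular majorant agreeing with `ν` there is modular
(`exists_modular_ge_of_supermodular`), and continuity of `ν` makes it countably additive
(`exists_mem_core_of_modular`). Conversely, certainty equivalents force the minimum to equal the
Choquet value. Applied to an act whose level sets are `A ∩ B` and `A ∪ B`, this gives a core measure
exact on both sets, and its additivity yields supermodularity. -/

namespace CRDU

/-! ### Modular majorants by Zorn's lemma. -/

/-- A monotone supermodular valuation on a Boolean algebra is dominated by a modular one that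
agrees with it on a given chain. -/
theorem exists_modular_ge_of_supermodular {α : Type*} [BooleanAlgebra α] (v : α → ℝ)
    (hbot : v ⊥ = 0) (hmono : Monotone v) (hsup : ∀ a b, v a + v b ≤ v (a ⊔ b) + v (a ⊓ b))
    (C : Set α) (hC : IsChain (· ≤ ·) C) :
    ∃ m : α → ℝ, v ≤ m ∧ Monotone m ∧ m ⊥ = 0 ∧ m ⊤ = v ⊤ ∧ EqOn m v C ∧
      ∀ a b, m a + m b = m (a ⊔ b) + m (a ⊓ b) := by
  let S : Set (α → ℝ) := {m | v ≤ m ∧ Monotone m ∧ m ⊥ = 0 ∧ m ⊤ = v ⊤ ∧ EqOn m v C ∧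
      ∀ a b, m a + m b ≤ m (a ⊔ b) + m (a ⊓ b)}
  have hchain : ∀ c ⊆ S, IsChain (· ≤ ·) c → ∀ y ∈ c, ∃ ub ∈ S, ∀ z ∈ c, z ≤ ub := by
    intro c hcS hc y hy
    have : Nonempty c := ⟨⟨y, hy⟩⟩
    have hbdd : ∀ a, BddAbove (range fun m : c => m.1 a) := by
      intro a
      refine ⟨v ⊤, ?_⟩
      rintro _ ⟨m, rfl⟩
      exact ((hcS m.2).2.1 le_top).trans (hcS m.2).2.2.2.1.le
    have hle : ∀ m ∈ c, ∀ a, m a ≤ ⨆ m : c, m.1 a := fun m hm a =>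
      le_ciSup (hbdd a) (⟨m, hm⟩ : c)
    have hconst : ∀ a r, (∀ m ∈ c, m a = r) → (⨆ m : c, m.1 a) = r := by
      intro a r h
      have : (fun m : c => m.1 a) = fun _ => r := funext fun m => h m.1 m.2
      rw [this, ciSup_const]
    refine ⟨fun a => ⨆ m : c, m.1 a, ⟨?_, ?_, ?_, ?_, ?_, ?_⟩, fun z hz a => hle z hz a⟩
    · exact fun a => ((hcS hy).1 a).trans (hle y hy a)
    · exact fun a b hab => ciSup_le fun m => ((hcS m.2).2.1 hab).trans (hle m.1 m.2 b)
    · exact hconst _ _ fun m hm => (hcS hm).2.2.1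
    · exact hconst _ _ fun m hm => (hcS hm).2.2.2.1
    · exact fun a ha => hconst _ _ fun m hm => (hcS hm).2.2.2.2.1 ha
    · intro a b
      -- The two suprema on the left may need different members of the chain; the larger of the two
      -- serves for both.
      have key : ∀ m ∈ c, ∀ n ∈ c,
          m a + n b ≤ (⨆ m : c, m.1 (a ⊔ b)) + ⨆ m : c, m.1 (a ⊓ b) := by
        intro m hm n hn
        rcases hc.total hm hn with h | h
        · have h1 := (hcS hn).2.2.2.2.2 a b
          have h2 := h a
          linarith [hle n hn (a ⊔ b), hle n hn (a ⊓ b)]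
        · have h1 := (hcS hm).2.2.2.2.2 a b
          have h2 := h b
          linarith [hle m hm (a ⊔ b), hle m hm (a ⊓ b)]
      rw [← le_sub_iff_add_le]
      refine ciSup_le fun m => ?_
      rw [le_sub_comm]
      refine ciSup_le fun n => ?_
      linarith [key m.1 m.2 n.1 n.2]
  obtain ⟨m, -, hm⟩ := zorn_le_nonempty₀ S hchain v
    ⟨le_rfl, hmono, hbot, rfl, fun _ _ => rfl, hsup⟩
  obtain ⟨hvm, hmm, hm0, hm1, hmC, hms⟩ := hm.prop
  -- The function `x ↦ m (a ⊔ x) + m (a ⊓ x) - m a` is again supermodular and at least `m`. If it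
  -- keeps the values on `C`, maximality makes it equal to `m`, which is modularity at `a`.
  have tight : ∀ a, (∀ x ∈ C, m (a ⊔ x) + m (a ⊓ x) - m a = m x) →
      ∀ b, m a + m b = m (a ⊔ b) + m (a ⊓ b) := by
    intro a ha b
    have hmem : (fun x => m (a ⊔ x) + m (a ⊓ x) - m a) ∈ S := by
      refine ⟨?_, ?_, ?_, ?_, ?_, ?_⟩
      · intro x
        have := hms a x
        have := hvm x
        dsimp only
        linarith
      · intro x y hxy
        have := hmm (sup_le_sup_left hxy a)
        have := hmm (inf_le_inf_left a hxy)
        dsimp only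
        linarith
      · simp [hm0]
      · simp [hm1]
      · exact fun x hx => (ha x hx).trans (hmC hx)
      · intro x y
        have h1 := hms (a ⊔ x) (a ⊔ y)
        have h2 := hms (a ⊓ x) (a ⊓ y)
        rw [← sup_sup_distrib_left, ← sup_inf_left] at h1
        rw [← inf_sup_left, ← inf_inf_distrib_left] at h2
        linarith
    have := hm.le_of_ge hmem (fun x => by have := hms a x; linarith) b
    have := hms a b
    linarith
  have hchain' : ∀ a ∈ C, ∀ b, m a + m b = m (a ⊔ b) + m (a ⊓ b) := by
    refine fun a ha => tight a fun x hx => ?_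
    rcases hC.total ha hx with h | h
    · rw [sup_eq_right.2 h, inf_eq_left.2 h]; ring
    · rw [sup_eq_left.2 h, inf_eq_right.2 h]; ring
  refine ⟨m, hvm, hmm, hm0, hm1, hmC, fun a => tight a fun x hx => ?_⟩
  -- Supermodularity at `(a, x)` and `(a, xᶜ)` sums to `2 m a + m ⊤ ≤ Σ`, while `h2` and `h3` give
  -- `Σ ≤ 2 m a + m ⊤`, where `Σ` is the sum of the four values on their left-hand sides. Hence all
  -- are equalities.
  have h1 := hchain' x hx xᶜ
  rw [sup_compl_eq_top, inf_compl_eq_bot] at h1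
  have h2 := hms (a ⊔ x) (a ⊔ xᶜ)
  have h3 := hms (a ⊓ x) (a ⊓ xᶜ)
  rw [← sup_sup_distrib_left, ← sup_inf_left, sup_compl_eq_top, inf_compl_eq_bot] at h2
  rw [← inf_sup_left, ← inf_inf_distrib_left, sup_compl_eq_top, inf_compl_eq_bot] at h3
  simp only [sup_top_eq, sup_bot_eq, inf_top_eq, inf_bot_eq] at h2 h3
  linarith [hms a x, hms a xᶜ]

/-! ### Choquet integrals with respect to capacities. -/

section Capacity

variable {Ω : Type*} [MeasurableSpace Ω]

theorem IsCapacity.mem_Icc {κ : Set Ω → ℝ} (hκ : IsCapacity κ) {A : Set Ω}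
    (hA : MeasurableSet A) : κ A ∈ Icc (0 : ℝ) 1 :=
  ⟨hκ.empty ▸ hκ.mono _ _ .empty hA (empty_subset _),
    hκ.univ ▸ hκ.mono _ _ hA .univ (subset_univ _)⟩

theorem isCapacity_real (μ : Measure Ω) [IsProbabilityMeasure μ] :
    IsCapacity fun A => μ.real A :=
  ⟨measureReal_empty, probReal_univ, fun _ _ _ _ h => measureReal_mono h⟩

theorem IsCapacity.distort {κ : Set Ω → ℝ} (hκ : IsCapacity κ) {g : ℝ → ℝ}
    (hg : IsStrictContDistortion g) : IsCapacity fun A => g (κ A) where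
  empty := by rw [hκ.empty, hg.zero]
  univ := by rw [hκ.univ, hg.one]
  mono A B hA hB h :=
    hg.strictMonoOn.monotoneOn (hκ.mem_Icc hA) (hκ.mem_Icc hB) (hκ.mono A B hA hB h)

theorem IsCapacity.antitone_level {κ : Set Ω → ℝ} (hκ : IsCapacity κ) {f : Ω → ℝ}
    (hf : Measurable f) : Antitone fun x => κ {ω | x < f ω} := fun _ _ hxy =>
  hκ.mono _ _ (measurableSet_lt measurable_const hf) (measurableSet_lt measurable_const hf)
    fun _ h => lt_of_le_of_lt hxy h

theorem IsCapacity.intervalIntegrable_level {κ : Set Ω → ℝ} (hκ : IsCapacity κ) {f : Ω → ℝ}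
    (hf : Measurable f) (a b : ℝ) :
    IntervalIntegrable (fun x => κ {ω | x < f ω}) volume a b :=
  (hκ.antitone_level hf).intervalIntegrable

theorem IsCapacity.level_eq_one {κ : Set Ω → ℝ} (hκ : IsCapacity κ) {f : Ω → ℝ} {a x : ℝ}
    (ha : ∀ ω, a ≤ f ω) (hx : x < a) : κ {ω | x < f ω} = 1 := by
  rw [← hκ.univ]
  congr 1
  exact eq_univ_of_forall fun ω => hx.trans_le (ha ω)

theorem IsCapacity.level_eq_zero {κ : Set Ω → ℝ} (hκ : IsCapacity κ) {f : Ω → ℝ} {b x : ℝ}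
    (hb : ∀ ω, f ω ≤ b) (hx : b ≤ x) : κ {ω | x < f ω} = 0 := by
  rw [← hκ.empty]
  congr 1
  exact eq_empty_of_forall_notMem fun ω h => absurd h (not_lt.2 ((hb ω).trans hx))

/-- The Choquet integral of a function with values in `[a, b]`. -/
theorem IsCapacity.choquet_eq {κ : Set Ω → ℝ} (hκ : IsCapacity κ) {f : Ω → ℝ}
    (hf : Measurable f) {a b : ℝ} (ha : ∀ ω, a ≤ f ω) (hb : ∀ ω, f ω ≤ b) :
    choquet κ f = a + ∫ x in a..b, κ {ω | x < f ω} := by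
  have hint := hκ.intervalIntegrable_level hf
  have hpos : ∫ x in Ioi (0 : ℝ), κ {ω | x < f ω} = ∫ x in (0 : ℝ)..max b 0, κ {ω | x < f ω} := by
    rw [intervalIntegral.integral_of_le (le_max_right _ _)]
    refine setIntegral_eq_of_subset_of_forall_sdiff_eq_zero measurableSet_Ioi
      Ioc_subset_Ioi_self fun x hx => hκ.level_eq_zero hb ?_
    by_contra! h
    exact hx.2 ⟨hx.1, h.le.trans (le_max_left _ _)⟩
  have hneg : ∫ x in Iic (0 : ℝ), (κ {ω | x < f ω} - 1) =
      ∫ x in min a 0..(0 : ℝ), (κ {ω | x < f ω} - 1) := by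
    -- The closed interval is needed: at `x = a` the level set may differ from `Ω`, so the integrand
    -- need not vanish there.
    rw [intervalIntegral.integral_of_le (min_le_right _ _), ← integral_Icc_eq_integral_Ioc]
    refine setIntegral_eq_of_subset_of_forall_sdiff_eq_zero measurableSet_Iic
      Icc_subset_Iic_self fun x hx => ?_
    rw [hκ.level_eq_one ha, sub_self]
    by_contra! h
    exact hx.2 ⟨(min_le_left _ _).trans h, hx.1⟩
  have hlow : ∫ x in min a 0..a, κ {ω | x < f ω} = a - min a 0 := by
    rw [intervalIntegral.integral_of_le (min_le_left _ _), integral_Ioc_eq_integral_Ioo,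
      setIntegral_congr_fun (g := fun _ => (1 : ℝ)) measurableSet_Ioo
        fun x hx => hκ.level_eq_one ha hx.2]
    simp
  have hhigh : ∫ x in b..max b 0, κ {ω | x < f ω} = 0 := by
    rw [intervalIntegral.integral_of_le (le_max_left _ _),
      setIntegral_congr_fun (g := fun _ => (0 : ℝ)) measurableSet_Ioc
        fun x hx => hκ.level_eq_zero hb hx.1.le]
    simp
  rw [choquet, hpos, hneg, intervalIntegral.integral_sub (hint _ _) (by simp)]
  have h1 := intervalIntegral.integral_add_adjacent_intervals (hint (min a 0) 0)
    (hint 0 (max b 0))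
  have h2 := intervalIntegral.integral_add_adjacent_intervals (hint (min a 0) a)
    (hint a b)
  have h3 := intervalIntegral.integral_add_adjacent_intervals (hint (min a 0) b)
    (hint b (max b 0))
  simp only [intervalIntegral.integral_const, smul_eq_mul, mul_one]
  linarith

theorem IsCapacity.choquet_const {κ : Set Ω → ℝ} (hκ : IsCapacity κ) (c : ℝ) :
    choquet κ (fun _ => c) = c := by
  rw [hκ.choquet_eq measurable_const (fun _ => le_rfl) fun _ => le_rfl]
  simp

theorem IsCapacity.choquet_mem_Icc {κ : Set Ω → ℝ} (hκ : IsCapacity κ) {f : Ω → ℝ}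
    (hf : Measurable f) {a b : ℝ} (hab : a ≤ b) (ha : ∀ ω, a ≤ f ω) (hb : ∀ ω, f ω ≤ b) :
    choquet κ f ∈ Icc a b := by
  rw [hκ.choquet_eq hf ha hb]
  have hmem : ∀ x, κ {ω | x < f ω} ∈ Icc (0 : ℝ) 1 := fun x =>
    hκ.mem_Icc (measurableSet_lt measurable_const hf)
  have h0 : 0 ≤ ∫ x in a..b, κ {ω | x < f ω} :=
    intervalIntegral.integral_nonneg hab fun x _ => (hmem x).1
  have h1 : ∫ x in a..b, κ {ω | x < f ω} ≤ ∫ _ in a..b, (1 : ℝ) :=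
    intervalIntegral.integral_mono_on hab (hκ.intervalIntegrable_level hf a b) (by simp)
      fun x _ => (hmem x).2
  simp only [intervalIntegral.integral_const, smul_eq_mul, mul_one] at h1
  constructor <;> linarith

theorem choquet_mono {κ κ' : Set Ω → ℝ} (hκ : IsCapacity κ) (hκ' : IsCapacity κ')
    (hle : ∀ A, MeasurableSet A → κ A ≤ κ' A) {f : Ω → ℝ} (hf : Measurable f) {a b : ℝ}
    (hab : a ≤ b) (ha : ∀ ω, a ≤ f ω) (hb : ∀ ω, f ω ≤ b) : choquet κ f ≤ choquet κ' f := by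
  rw [hκ.choquet_eq hf ha hb, hκ'.choquet_eq hf ha hb]
  gcongr
  exact intervalIntegral.integral_mono_on hab (hκ.intervalIntegrable_level hf a b)
    (hκ'.intervalIntegrable_level hf a b)
    fun x _ => hle _ (measurableSet_lt measurable_const hf)

/-- If two ordered capacities give the same Choquet integral of `f`, then they agree on almost
every upper level set of `f`. -/
theorem level_ae_eq_of_choquet_eq {κ κ' : Set Ω → ℝ} (hκ : IsCapacity κ) (hκ' : IsCapacity κ')
    (hle : ∀ A, MeasurableSet A → κ A ≤ κ' A) {f : Ω → ℝ} (hf : Measurable f) {a b : ℝ}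
    (hab : a ≤ b) (ha : ∀ ω, a ≤ f ω) (hb : ∀ ω, f ω ≤ b) (h : choquet κ f = choquet κ' f) :
    ∀ᵐ x ∂volume.restrict (Ioc a b), κ {ω | x < f ω} = κ' {ω | x < f ω} := by
  have hi := hκ.intervalIntegrable_level hf a b
  have hi' := hκ'.intervalIntegrable_level hf a b
  rw [hκ.choquet_eq hf ha hb, hκ'.choquet_eq hf ha hb, add_right_inj,
    intervalIntegral.integral_of_le hab, intervalIntegral.integral_of_le hab] at h
  exact (integral_eq_iff_of_ae_le hi.1 hi'.1 (ae_of_all _ fun x =>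
    hle _ (measurableSet_lt measurable_const hf))).1 h

theorem exists_mem_Ioo_of_ae {p : ℝ → Prop} {a b c d : ℝ}
    (h : ∀ᵐ x ∂volume.restrict (Ioc a b), p x) (hac : a ≤ c) (hcd : c < d) (hdb : d ≤ b) :
    ∃ x ∈ Ioo c d, p x := by
  have h' : ∀ᵐ x ∂volume.restrict (Ioo c d), p x :=
    ae_restrict_of_ae_restrict_of_subset
      ((Ioo_subset_Ioo hac hdb).trans Ioo_subset_Ioc_self) h
  have : (ae (volume.restrict (Ioo c d))).NeBot := by
    rw [ae_neBot, Ne, Measure.restrict_eq_zero]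
    simpa using hcd
  obtain ⟨x, hx⟩ := (h'.and (ae_restrict_mem measurableSet_Ioo)).exists
  exact ⟨x, hx.2, hx.1⟩

/-! ### Core measures exact on a chain. -/

/-- A finitely additive set function with total mass one dominating a continuous capacity is
countably additive. -/
theorem exists_mem_core_of_modular {ν : Set Ω → ℝ} (hν : IsContinuousCapacity ν)
    (m : {A : Set Ω // MeasurableSet A} → ℝ) (hle : ∀ A, ν A.1 ≤ m A) (hmono : Monotone m)
    (hbot : m ⊥ = 0) (htop : m ⊤ = 1)
    (hmod : ∀ A B, m A + m B = m (A ⊔ B) + m (A ⊓ B)) :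
    ∃ μ ∈ core ν, ∀ A, (μ : Measure Ω).real A.1 = m A := by
  have hnn : ∀ A, 0 ≤ m A := fun A => hbot ▸ hmono bot_le
  have hsum : ∀ f : ℕ → Set Ω, (hf : ∀ i, MeasurableSet (f i)) → Pairwise (Function.onFun Disjoint f) →
      HasSum (fun i => m ⟨f i, hf i⟩) (m ⟨⋃ i, f i, .iUnion hf⟩) := by
    intro f hf hd
    rw [hasSum_iff_tendsto_nat_of_nonneg fun i => hnn _]
    have hU : ∀ n, MeasurableSet (⋃ i ∈ Finset.range n, f i) := fun n =>
      Finset.measurableSet_biUnion _ fun i _ => hf i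
    have hpart : ∀ n, ∑ i ∈ Finset.range n, m ⟨f i, hf i⟩ =
        m ⟨⋃ i ∈ Finset.range n, f i, hU n⟩ := by
      intro n
      induction n with
      | zero =>
        rw [Finset.sum_range_zero, ← hbot]
        congr 1
        ext1
        simp
      | succ n ih =>
        rw [Finset.sum_range_succ, ih, hmod]
        have h1 : (⟨⋃ i ∈ Finset.range n, f i, hU n⟩ ⊔ ⟨f n, hf n⟩ :
            {A : Set Ω // MeasurableSet A}) = ⟨⋃ i ∈ Finset.range (n + 1), f i, hU (n + 1)⟩ := by
          ext1
          change (⋃ i ∈ Finset.range n, f i) ∪ f n = ⋃ i ∈ Finset.range (n + 1), f i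
          rw [Finset.range_add_one, Finset.set_biUnion_insert, union_comm]
        have h2 : (⟨⋃ i ∈ Finset.range n, f i, hU n⟩ ⊓ ⟨f n, hf n⟩ :
            {A : Set Ω // MeasurableSet A}) = ⊥ := by
          ext1
          change (⋃ i ∈ Finset.range n, f i) ∩ f n = ∅
          rw [← disjoint_iff_inter_eq_empty, disjoint_iUnion₂_left]
          exact fun i hi => hd (Finset.mem_range.1 hi).ne
        rw [h1, h2, hbot, add_zero]
    simp_rw [hpart]
    set U : {A : Set Ω // MeasurableSet A} := ⟨⋃ i, f i, .iUnion hf⟩ with hUdef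
    -- the partial unions together with the complement of `U` increase to the whole space
    let T : ℕ → Set Ω := fun n => (⋃ i ∈ Finset.range n, f i) ∪ (⋃ i, f i)ᶜ
    have hT : ∀ n, MeasurableSet (T n) := fun n => (hU n).union (MeasurableSet.iUnion hf).compl
    have hTmono : Monotone T := fun a b hab => union_subset_union_left _
      (biUnion_subset_biUnion_left (by simpa using hab))
    have hTU : ⋃ n, T n = univ := by
      refine eq_univ_of_forall fun ω => ?_
      by_cases hω : ω ∈ ⋃ i, f i
      · obtain ⟨i, hi⟩ := mem_iUnion.1 hω
        exact mem_iUnion.2 ⟨i + 1, Or.inl (mem_biUnion (Finset.self_mem_range_succ i) hi)⟩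
      · exact mem_iUnion.2 ⟨0, Or.inr hω⟩
    have hlim := hν.upward T hT hTmono
    rw [hTU, hν.univ] at hlim
    have hcompl : m U + m Uᶜ = 1 := by
      rw [hmod, sup_compl_eq_top, inf_compl_eq_bot, hbot, htop, add_zero]
    -- Squeeze: `ν (T n) - m Uᶜ` is at most `m` of the partial union, which is at most `m U`, and
    -- the lower bound tends to `1 - m Uᶜ = m U`.
    refine tendsto_of_tendsto_of_tendsto_of_le_of_le (g := fun n => ν (T n) - m Uᶜ)
      (h := fun _ => m U) ?_ tendsto_const_nhds ?_ ?_
    · have := hlim.sub_const (m Uᶜ)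
      rwa [← hcompl, add_sub_cancel_right] at this
    · intro n
      have h1 := hle ⟨T n, hT n⟩
      have h2 := hmod ⟨⋃ i ∈ Finset.range n, f i, hU n⟩ Uᶜ
      have h3 := hnn (⟨⋃ i ∈ Finset.range n, f i, hU n⟩ ⊓ Uᶜ)
      change ν (T n) ≤ m (⟨⋃ i ∈ Finset.range n, f i, hU n⟩ ⊔ Uᶜ) at h1
      change ν (T n) - m Uᶜ ≤ m ⟨⋃ i ∈ Finset.range n, f i, hU n⟩
      linarith
    · exact fun n => hmono (iUnion₂_subset fun i _ => subset_iUnion f i)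
  let μ : Measure Ω := Measure.ofMeasurable (fun A hA => ENNReal.ofReal (m ⟨A, hA⟩))
    (by rw [ENNReal.ofReal_eq_zero]; exact hbot.le)
    (by
      intro f hf hd
      rw [← (hsum f hf hd).tsum_eq, ENNReal.ofReal_tsum_of_nonneg (fun i => hnn _)
        (hsum f hf hd).summable])
  have hμ : ∀ A (hA : MeasurableSet A), μ A = ENNReal.ofReal (m ⟨A, hA⟩) := fun A hA =>
    Measure.ofMeasurable_apply A hA
  have hμr : ∀ A : {A : Set Ω // MeasurableSet A}, μ.real A.1 = m A := fun A => by
    rw [measureReal_def, hμ A.1 A.2, ENNReal.toReal_ofReal (hnn A)]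
  have : IsProbabilityMeasure μ := ⟨by
    rw [hμ univ .univ, ← ENNReal.ofReal_one, ← htop]; rfl⟩
  exact ⟨⟨μ, this⟩, fun A hA => (hle ⟨A, hA⟩).trans (hμr ⟨A, hA⟩).ge, hμr⟩

/-- For a supermodular continuous capacity, some measure in the core is exact on all upper level
sets of a given measurable function. -/
theorem exists_mem_core_eq_on_levels {ν : Set Ω → ℝ} (hν : IsContinuousCapacity ν)
    (hsup : IsSupermodular ν) {f : Ω → ℝ} (hf : Measurable f) :
    ∃ μ ∈ core ν, ∀ x, (μ : Measure Ω).real {ω | x < f ω} = ν {ω | x < f ω} := by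
  let L : ℝ → {A : Set Ω // MeasurableSet A} := fun x =>
    ⟨{ω | x < f ω}, measurableSet_lt measurable_const hf⟩
  have hL : Antitone L := fun x y hxy ω h => lt_of_le_of_lt hxy h
  obtain ⟨m, hle, hmono, hbot, htop, hC, hmod⟩ := exists_modular_ge_of_supermodular
    (fun A : {A : Set Ω // MeasurableSet A} => ν A.1) hν.empty
    (fun A B h => hν.mono _ _ A.2 B.2 h) (fun A B => hsup _ _ A.2 B.2) (range L)
    hL.isChain_range
  obtain ⟨μ, hμ, hμm⟩ := exists_mem_core_of_modular hν m hle hmono hbot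
    (htop.trans hν.univ) hmod
  exact ⟨μ, hμ, fun x => (hμm (L x)).trans (hC (mem_range_self x))⟩

theorem distort_le_of_mem_core {ν : Set Ω → ℝ} (hν : IsCapacity ν) {g : ℝ → ℝ}
    (hg : IsStrictContDistortion g) {μ : ProbabilityMeasure Ω} (hμ : μ ∈ core ν) (A : Set Ω)
    (hA : MeasurableSet A) : g (ν A) ≤ g ((μ : Measure Ω).real A) :=
  hg.strictMonoOn.monotoneOn (hν.mem_Icc hA) ((isCapacity_real (μ : Measure Ω)).mem_Icc hA)
    (hμ A hA)

/-! ### The two implications. -/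

/-- The constant act. -/
def Act.const (Ω : Type*) [MeasurableSpace Ω] (c : ℝ) : Act Ω :=
  ⟨fun _ => c, measurable_const, |c|, fun _ => le_rfl⟩

theorem Act.exists_utility_bounds (X : Act Ω) {u : ℝ → ℝ} (hu : Monotone u) :
    ∃ a b, a ≤ b ∧ (∀ ω, u a ≤ u (X.toFun ω)) ∧ ∀ ω, u (X.toFun ω) ≤ u b := by
  obtain ⟨C, hC⟩ := X.bounded'
  exact ⟨-|C|, |C|, neg_le_self (abs_nonneg C),
    fun ω => hu (neg_le_of_abs_le ((hC ω).trans (le_abs_self C))),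
    fun ω => hu (le_of_abs_le ((hC ω).trans (le_abs_self C)))⟩

/-- The Choquet functional itself serves as `V`: it is a lower bound over the core, attained at a
measure exact on the level sets of `u ∘ X`. -/
theorem robustAggregation_of_isSupermodular {pref : Act Ω → Act Ω → Prop} {u g : ℝ → ℝ}
    {ν : Set Ω → ℝ} (hu : Monotone u) (hg : IsStrictContDistortion g)
    (hν : IsContinuousCapacity ν)
    (hrep : ∀ X Y : Act Ω, pref X Y ↔ choquet (fun A => g (ν A)) (fun ω => u (X.toFun ω)) ≥
      choquet (fun A => g (ν A)) (fun ω => u (Y.toFun ω)))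
    (hsup : IsSupermodular ν) : RobustAggregation pref u g ν := by
  refine ⟨fun X => choquet (fun A => g (ν A)) (fun ω => u (X.toFun ω)), fun X => ⟨?_, ?_⟩, hrep⟩
  · obtain ⟨μ, hμ, hx⟩ := exists_mem_core_eq_on_levels hν hsup (hu.measurable.comp X.measurable')
    exact ⟨μ, hμ, by simp only [choquet, Function.comp_apply] at hx ⊢; simp only [hx]⟩
  · rintro _ ⟨μ, hμ, rfl⟩
    obtain ⟨a, b, hab, ha, hb⟩ := X.exists_utility_bounds hu
    exact choquet_mono (hν.toIsCapacity.distort hg) ((isCapacity_real (μ : Measure Ω)).distort hg)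
      (distort_le_of_mem_core hν.toIsCapacity hg hμ) (hu.measurable.comp X.measurable')
      (hu hab) ha hb

/-- Under robust aggregation the minimal rank-dependent utility is the Choquet rank-dependent
utility itself, because both assign to each act its certainty equivalent. -/
theorem exists_core_choquet_eq {pref : Act Ω → Act Ω → Prop} {u g : ℝ → ℝ}
    {ν : Set Ω → ℝ} (hu : Monotone u) (huc : Continuous u) (hg : IsStrictContDistortion g)
    (hν : IsCapacity ν)
    (hrep : ∀ X Y : Act Ω, pref X Y ↔ choquet (fun A => g (ν A)) (fun ω => u (X.toFun ω)) ≥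
      choquet (fun A => g (ν A)) (fun ω => u (Y.toFun ω)))
    (hrob : RobustAggregation pref u g ν) (X : Act Ω) :
    ∃ μ ∈ core ν, choquet (fun A => g (ν A)) (fun ω => u (X.toFun ω)) =
      choquet (fun A => g ((μ : Measure Ω).real A)) (fun ω => u (X.toFun ω)) := by
  obtain ⟨V, hV, hpref⟩ := hrob
  obtain ⟨a, b, hab, ha, hb⟩ := X.exists_utility_bounds hu
  obtain ⟨c, -, hc⟩ := intermediate_value_Icc hab huc.continuousOn
    ((hν.distort hg).choquet_mem_Icc (hu.measurable.comp X.measurable') (hu hab) ha hb)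
  have hcν : choquet (fun A => g (ν A)) (fun ω => u ((Act.const Ω c).toFun ω)) = u c :=
    (hν.distort hg).choquet_const (u c)
  -- Every core measure gives a constant act the value `u c`, so `V` and the Choquet functional
  -- share a scale on constants.
  have hVc : V (Act.const Ω c) = u c := by
    obtain ⟨μ, -, hμ⟩ := (hV (Act.const Ω c)).1
    exact hμ.symm.trans (((isCapacity_real (μ : Measure Ω)).distort hg).choquet_const (u c))
  have h1 := (hpref X (Act.const Ω c)).1 ((hrep _ _).2 (hcν.trans hc).le)
  have h2 := (hpref (Act.const Ω c) X).1 ((hrep _ _).2 (hcν.trans hc).ge)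
  obtain ⟨μ, hμ, hμX⟩ := (hV X).1
  exact ⟨μ, hμ, hc.symm.trans (hVc.symm.trans ((le_antisymm h1 h2).trans hμX.symm))⟩

open Classical in
/-- The act with values `2` on `A`, `1` on `B \ A` and `0` elsewhere, for `A ⊆ B`. -/
noncomputable def Act.twoStep {A B : Set Ω} (hA : MeasurableSet A) (hB : MeasurableSet B) : Act Ω where
  toFun ω := if ω ∈ A then 2 else if ω ∈ B then 1 else 0
  measurable' := Measurable.ite hA measurable_const
    (Measurable.ite hB measurable_const measurable_const)
  bounded' := ⟨2, fun ω => by split_ifs <;> norm_num⟩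

theorem isSupermodular_of_robustAggregation {pref : Act Ω → Act Ω → Prop} {u g : ℝ → ℝ}
    {ν : Set Ω → ℝ} (hu : StrictMono u) (huc : Continuous u) (hg : IsStrictContDistortion g)
    (hν : IsCapacity ν)
    (hrep : ∀ X Y : Act Ω, pref X Y ↔ choquet (fun A => g (ν A)) (fun ω => u (X.toFun ω)) ≥
      choquet (fun A => g (ν A)) (fun ω => u (Y.toFun ω)))
    (hrob : RobustAggregation pref u g ν) : IsSupermodular ν := by
  intro A B hA hB
  have hI := hA.inter hB
  have hU := hA.union hB
  have hIU : A ∩ B ⊆ A ∪ B := inter_subset_left.trans subset_union_left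
  set X := Act.twoStep hI hU with hX
  obtain ⟨μ, hμ, heq⟩ := exists_core_choquet_eq hu.monotone huc hg hν hrep hrob X
  have h01 : u 0 < u 1 := hu one_pos
  have h12 : u 1 < u 2 := hu one_lt_two
  have hval : ∀ ω, (ω ∈ A ∩ B ∧ X.toFun ω = 2) ∨ (ω ∉ A ∩ B ∧ ω ∈ A ∪ B ∧ X.toFun ω = 1) ∨
      (ω ∉ A ∩ B ∧ ω ∉ A ∪ B ∧ X.toFun ω = 0) := by
    intro ω
    by_cases h1 : ω ∈ A ∩ B
    · exact Or.inl ⟨h1, if_pos h1⟩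
    · by_cases h2 : ω ∈ A ∪ B
      · exact Or.inr (Or.inl ⟨h1, h2, (if_neg h1).trans (if_pos h2)⟩)
      · exact Or.inr (Or.inr ⟨h1, h2, (if_neg h1).trans (if_neg h2)⟩)
  have hae := level_ae_eq_of_choquet_eq (hν.distort hg)
    ((isCapacity_real (μ : Measure Ω)).distort hg) (distort_le_of_mem_core hν hg hμ)
    (hu.monotone.measurable.comp X.measurable') (h01.trans h12).le
    (fun ω => by
      rcases hval ω with ⟨-, h⟩ | ⟨-, -, h⟩ | ⟨-, -, h⟩ <;>
        rw [Function.comp_apply, h] <;> linarith)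
    (fun ω => by
      rcases hval ω with ⟨-, h⟩ | ⟨-, -, h⟩ | ⟨-, -, h⟩ <;>
        rw [Function.comp_apply, h] <;> linarith) heq
  -- Strict monotonicity of `g` removes the distortion.
  have hinj : ∀ D, MeasurableSet D → g (ν D) = g ((μ : Measure Ω).real D) →
      ν D = (μ : Measure Ω).real D := fun D hD h =>
    hg.strictMonoOn.injOn (hν.mem_Icc hD) ((isCapacity_real (μ : Measure Ω)).mem_Icc hD) h
  have hU' : ν (A ∪ B) = (μ : Measure Ω).real (A ∪ B) := by
    -- Thresholds in `(u 0, u 1)` all cut out `A ∪ B`, and those in `(u 1, u 2)` cut out `A ∩ B`, so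
    -- almost-everywhere equality suffices.
    obtain ⟨x, hx, h⟩ := exists_mem_Ioo_of_ae hae le_rfl h01 h12.le
    have hset : {ω | x < (u ∘ X.toFun) ω} = A ∪ B := by
      ext ω
      rw [mem_ofPred_eq, Function.comp_apply]
      rcases hval ω with ⟨h1, h⟩ | ⟨-, h1, h⟩ | ⟨-, h1, h⟩ <;> rw [h]
      · exact iff_of_true (hx.2.trans h12) (hIU h1)
      · exact iff_of_true hx.2 h1
      · exact iff_of_false hx.1.not_gt h1
    rw [hset] at h
    exact hinj _ hU h
  have hI' : ν (A ∩ B) = (μ : Measure Ω).real (A ∩ B) := by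
    obtain ⟨x, hx, h⟩ := exists_mem_Ioo_of_ae hae h01.le h12 le_rfl
    have hset : {ω | x < (u ∘ X.toFun) ω} = A ∩ B := by
      ext ω
      rw [mem_ofPred_eq, Function.comp_apply]
      rcases hval ω with ⟨h1, h⟩ | ⟨h1, -, h⟩ | ⟨h1, -, h⟩ <;> rw [h]
      · exact iff_of_true hx.2 h1
      · exact iff_of_false hx.1.not_gt h1
      · exact iff_of_false (h01.trans hx.1).not_gt h1
    rw [hset] at h
    exact hinj _ hI h
  rw [hU', hI', measureReal_union_add_inter hB]
  exact add_le_add (hμ A hA) (hμ B hB)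

end Capacity

end CRDU

theorem mainTheorem5 {Ω : Type*} (𝒢 : MeasurableSpace Ω) [mΩ : MeasurableSpace Ω]
    (h𝒢 : 𝒢 ≤ mΩ) (P : Measure Ω) [IsProbabilityMeasure P]
    (hatomless : CRDU.IsAtomless 𝒢 P)
    (pref : CRDU.Act Ω → CRDU.Act Ω → Prop) (hpref : CRDU.IsPreferenceRelation pref)
    (u g : ℝ → ℝ) (ν : Set Ω → ℝ) (hCRDU : CRDU.IsCRDU 𝒢 P pref u g ν) :
    CRDU.RobustAggregation pref u g ν ↔ CRDU.IsSupermodular ν :=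
  ⟨CRDU.isSupermodular_of_robustAggregation hCRDU.utility_strictMono hCRDU.utility_continuous
      hCRDU.distortion hCRDU.capacity.toIsCapacity hCRDU.rep,
    CRDU.robustAggregation_of_isSupermodular hCRDU.utility_strictMono.monotone hCRDU.distortion
      hCRDU.capacity hCRDU.rep⟩
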